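/- Let $k$ be a field and let $Q$ be a finite quiver (loops and multiple arrows allowed) with vertex set $I$ and incidence matrix $C=(c_{ij})_{i,j\in I}$, where $c_{ij}$ is the number of arrows from $j$ to $i$. Let $kQ$ be the path algebra of $Q$, in which $pq$ is the path $q$ followed by the path $p$ (and $pq=0$ if $q$ does not end where $p$ starts), graded by path length. Let $\mathsf{Gr}(kQ)$ be the category of $\mathbb{Z}$-graded left $kQ$-modules with degree-preserving homomorphisms, let $\mathsf{Fdim}(kQ)$ be its full subcategory of modules that are the sum of their finite-dimensional submodules, and let $\mathsf{QGr}(kQ)=\mathsf{Gr}(kQ)/\mathsf{Fdim}(kQ)$ be the quotient category, i.e. the localization of $\mathsf{Gr}(kQ)$ at the morphisms whose kernel and cokernel lie in $\mathsf{Fdim}(kQ)$. Let $m\ge 1$ and let $Q^{(m)}$ be the quiver with the same vertices as $Q$ whose arrows from $i$ to $j$ are the paths of length $m$ from $i$ to $j$ in $Q$. Then $Q^{(m)}$ is a finite quiver with incidence matrix $C^m$, and there is an equivalence of categories $$\mathsf{QGr}(kQ)\;\equiv\;\mathsf{QGr}(kQ^{(m)}).$$ More generally, $\mathsf{QGr}(kQ)\equiv\mathsf{QGr}(kQ')$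 for every finite quiver $Q'$ whose vertex set is identified with $I$ and whose incidence matrix is $C^m$. -/

import Mathlib

open CategoryTheory

universe u v w t

noncomputable section

/-! ### The path algebra -/

/-- The set of all paths of a quiver, including the trivial ones. -/
structure QuiverPath (V : Type v) [Quiver.{w} V] where
  /-- the starting vertex -/
  src : V
  /-- the vertex at which the path terminates -/
  tgt : V
  /-- the path itself -/
  path : Quiver.Path src tgt

/-- The length of a path. -/
def QuiverPath.length {V : Type v} [Quiver.{w} V] (p : QuiverPath V) : ℕ := p.path.length

/-- The trivial path at a vertex. -/
def QuiverPath.nil {V : Type v} [Quiver.{w} V] (i : V) : QuiverPath V := ⟨i, i, Quiver.Path.nil⟩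

/-- The path algebra `kQ`, as a `k`-vector space: the paths are a basis. -/
def PathAlgebra (k : Type u) [Field k] (V : Type v) [Quiver.{w} V] : Type (max u v w) :=
  QuiverPath V →₀ k

namespace PathAlgebra

variable {k : Type u} [Field k] {V : Type v} [Quiver.{w} V]

instance : AddCommGroup (PathAlgebra k V) := inferInstanceAs (AddCommGroup (QuiverPath V →₀ k))

instance : Module k (PathAlgebra k V) := inferInstanceAs (Module k (QuiverPath V →₀ k))

variable (k) in
/-- The element of the path algebra given by a single path. -/
def ofPath (p : QuiverPath V) : PathAlgebra k V := Finsupp.single p (1 : k)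

variable (k) in
open Classical in
/-- The product of two paths: `p q` is "first `q`, then `p`" if `q` ends where `p` starts,
and zero otherwise. -/
def pathMul (p q : QuiverPath V) : PathAlgebra k V :=
  if h : q.tgt = p.src then ofPath k ⟨q.src, p.tgt, (q.path.cast rfl h).comp p.path⟩ else 0

variable (k V) in
/-- The bilinear extension of the product of paths. -/
def mulLin : PathAlgebra k V →ₗ[k] PathAlgebra k V →ₗ[k] PathAlgebra k V :=
  Finsupp.linearCombination k fun p => Finsupp.linearCombination k fun q => pathMul k p q

instance : Mul (PathAlgebra k V) := ⟨fun x y => mulLin k V x y⟩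

/-- The identity is the sum of the trivial paths. -/
instance [Fintype V] : One (PathAlgebra k V) := ⟨∑ i : V, ofPath k (QuiverPath.nil i)⟩

theorem mul_def (x y : PathAlgebra k V) : x * y = mulLin k V x y := rfl

theorem one_def [Fintype V] :
    (1 : PathAlgebra k V) = ∑ i : V, ofPath k (QuiverPath.nil i) := rfl

theorem ofPath_mul_ofPath (p q : QuiverPath V) : ofPath k p * ofPath k q = pathMul k p q := by
  rw [mul_def, mulLin, ofPath, ofPath]
  erw [Finsupp.linearCombination_single, one_smul, Finsupp.linearCombination_single, one_smul]

/-- Two linear maps that agree on the paths are equal. -/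
theorem hom_ext {M : Type*} [AddCommMonoid M] [Module k M] {f g : PathAlgebra k V →ₗ[k] M}
    (h : ∀ p, f (ofPath k p) = g (ofPath k p)) : f = g :=
  Finsupp.lhom_ext' fun p => LinearMap.ext_ring (h p)

theorem ofPath_mul_comp {a b c : V} (p : Quiver.Path b c) (q : Quiver.Path a b) :
    ofPath k (⟨b, c, p⟩ : QuiverPath V) * ofPath k ⟨a, b, q⟩ = ofPath k ⟨a, c, q.comp p⟩ := by
  simp [ofPath_mul_ofPath, pathMul]

theorem ofPath_mul_eq_zero {p q : QuiverPath V} (h : q.tgt ≠ p.src) :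
    ofPath k p * ofPath k q = 0 := by
  simp [ofPath_mul_ofPath, pathMul, h]

theorem mul_assoc_ofPath (p q r : QuiverPath V) :
    ofPath k p * ofPath k q * ofPath k r = ofPath k p * (ofPath k q * ofPath k r) := by
  obtain ⟨c, d, p⟩ := p
  obtain ⟨b, c', q⟩ := q
  obtain ⟨a, b', r⟩ := r
  by_cases h1 : c' = c
  · subst h1
    rw [ofPath_mul_comp]
    by_cases h2 : b' = b
    · subst h2
      rw [ofPath_mul_comp, ofPath_mul_comp, ofPath_mul_comp, Quiver.Path.comp_assoc]
    · rw [ofPath_mul_eq_zero h2, ofPath_mul_eq_zero h2]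
      simp [mul_def]
  · rw [ofPath_mul_eq_zero (q := ⟨b, c', q⟩) h1]
    by_cases h2 : b' = b
    · subst h2
      rw [ofPath_mul_comp, ofPath_mul_eq_zero (q := ⟨a, c', _⟩) h1]
      simp [mul_def]
    · rw [ofPath_mul_eq_zero (p := ⟨b, c', q⟩) h2]
      simp [mul_def]

/-- Induction on the elements of the path algebra. -/
theorem induct {P : PathAlgebra k V → Prop} (x : PathAlgebra k V) (h0 : P 0)
    (hadd : ∀ x y, P x → P y → P (x + y)) (hs : ∀ (c : k) p, P (c • ofPath k p)) : P x := by
  refine Finsupp.induction_linear x h0 hadd fun p c => ?_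
  have := hs c p
  rwa [show c • ofPath k p = (Finsupp.single p c : QuiverPath V →₀ k) from
    (Finsupp.smul_single c p (1 : k)).trans (by simp)] at this

theorem mul_add' (x y z : PathAlgebra k V) : x * (y + z) = x * y + x * z :=
  map_add (mulLin k V x) y z

theorem add_mul' (x y z : PathAlgebra k V) : (x + y) * z = x * z + y * z :=
  LinearMap.map_add₂ (mulLin k V) x y z

theorem zero_mul' (x : PathAlgebra k V) : 0 * x = 0 :=
  LinearMap.map_zero₂ (mulLin k V) x

theorem mul_zero' (x : PathAlgebra k V) : x * 0 = 0 :=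
  map_zero (mulLin k V x)

theorem smul_mul' (c : k) (x y : PathAlgebra k V) : c • x * y = c • (x * y) :=
  LinearMap.map_smul₂ (mulLin k V) c x y

theorem mul_smul' (c : k) (x y : PathAlgebra k V) : x * c • y = c • (x * y) :=
  map_smul (mulLin k V x) c y

theorem mul_assoc' (x y z : PathAlgebra k V) : x * y * z = x * (y * z) := by
  induction x using induct with
  | h0 => simp only [zero_mul']
  | hadd x x' h h' => simp only [add_mul', h, h']
  | hs c p =>
    induction y using induct with
    | h0 => simp only [zero_mul', mul_zero']
    | hadd y y' h h' => simp only [add_mul', mul_add', h, h']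
    | hs c p =>
      induction z using induct with
      | h0 => simp only [mul_zero']
      | hadd z z' h h' => simp only [mul_add', h, h']
      | hs c p => simp only [smul_mul', mul_smul', mul_assoc_ofPath]

theorem one_mul' [Fintype V] (x : PathAlgebra k V) : 1 * x = x := by
  classical
  induction x using induct with
  | h0 => exact mul_zero' 1
  | hadd x y h h' => rw [mul_add', h, h']
  | hs c p =>
    rw [mul_smul', one_def, mul_def, map_sum, LinearMap.sum_apply,
      Finset.sum_eq_single p.tgt]
    · exact congrArg _ ((ofPath_mul_comp Quiver.Path.nil p.path).trans (by simp))
    · intro i _ hi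
      exact ofPath_mul_eq_zero (p := QuiverPath.nil i) (fun h => hi h.symm)
    · simp

theorem mul_one' [Fintype V] (x : PathAlgebra k V) : x * 1 = x := by
  classical
  induction x using induct with
  | h0 => exact zero_mul' 1
  | hadd x y h h' => rw [add_mul', h, h']
  | hs c p =>
    rw [smul_mul', one_def, mul_def, map_sum, Finset.sum_eq_single p.src]
    · exact congrArg _ ((ofPath_mul_comp p.path Quiver.Path.nil).trans (by simp))
    · intro i _ hi
      exact ofPath_mul_eq_zero (q := QuiverPath.nil i) hi
    · simp

instance [Fintype V] : Ring (PathAlgebra k V) where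
  __ := (inferInstance : AddCommGroup (PathAlgebra k V))
  __ := (inferInstance : Mul (PathAlgebra k V))
  __ := (inferInstance : One (PathAlgebra k V))
  left_distrib := mul_add'
  right_distrib := add_mul'
  zero_mul := zero_mul'
  mul_zero := mul_zero'
  mul_assoc := mul_assoc'
  one_mul := one_mul'
  mul_one := mul_one'

instance [Fintype V] : Algebra k (PathAlgebra k V) :=
  Algebra.ofModule smul_mul' (fun c x y => mul_smul' c x y)

variable (k V) in
/-- The standard grading: the component of degree `n` is spanned by the paths of length `n`. -/
def degree (n : ℕ) : Submodule k (PathAlgebra k V) :=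
  Submodule.span k {x | ∃ p : QuiverPath V, p.length = n ∧ x = ofPath k p}

end PathAlgebra

/-! ### Graded modules over the path algebra -/

/-- A `ℤ`-graded left module over the path algebra `kQ` of a finite quiver `Q`. -/
structure GrMod (k : Type u) [Field k] (V : Type v) [Quiver.{w} V] [Fintype V] where
  /-- the underlying left module -/
  carrier : Type t
  [addCommGroup : AddCommGroup carrier]
  [moduleBase : Module k carrier]
  [module : Module (PathAlgebra k V) carrier]
  [isScalarTower : IsScalarTower k (PathAlgebra k V) carrier]
  /-- the component of each degree -/
  gr : ℤ → Submodule k carrier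
  /-- the module is the direct sum of its components -/
  isInternal : DirectSum.IsInternal gr
  smul_mem : ∀ (n : ℕ) (i : ℤ) (a : PathAlgebra k V) (x : carrier),
    a ∈ PathAlgebra.degree k V n → x ∈ gr i → a • x ∈ gr (n + i)

namespace GrMod

variable {k : Type u} [Field k] {V : Type v} [Quiver.{w} V] [Fintype V]

attribute [instance] addCommGroup moduleBase module isScalarTower

/-- A degree-preserving homomorphism of graded left `kQ`-modules. -/
@[ext]
structure Hom (M N : GrMod.{u, v, w, t} k V) where
  /-- the underlying homomorphism of left modules -/
  toLinearMap : M.carrier →ₗ[PathAlgebra k V] N.carrier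
  map_mem : ∀ (i : ℤ) (x : M.carrier), x ∈ M.gr i → toLinearMap x ∈ N.gr i

/-- The category `Gr(kQ)`. -/
instance : Category (GrMod.{u, v, w, t} k V) where
  Hom := Hom
  id M := ⟨LinearMap.id, fun _ _ hx => hx⟩
  comp f g := ⟨g.toLinearMap.comp f.toLinearMap, fun i x hx => g.map_mem i _ (f.map_mem i x hx)⟩

end GrMod

/-! ### The quotient category -/

/-- A left `kQ`-module is the sum of its finite-dimensional submodules. -/
def IsSumOfFinDim (k : Type u) [Field k] (V : Type v) [Quiver.{w} V] [Fintype V]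
    (M : Type t) [AddCommGroup M] [Module k M] [Module (PathAlgebra k V) M]
    [IsScalarTower k (PathAlgebra k V) M] : Prop :=
  sSup {F : Submodule (PathAlgebra k V) M | FiniteDimensional k F} = ⊤

/-- The morphisms of `Gr(kQ)` whose kernel and cokernel both lie in `Fdim(kQ)`, the
subcategory of the modules that are the sum of their finite-dimensional submodules. -/
def isoModFdim (k : Type u) [Field k] (V : Type v) [Quiver.{w} V] [Fintype V] :
    MorphismProperty (GrMod.{u, v, w, t} k V) := fun _ N f =>
  IsSumOfFinDim k V (LinearMap.ker f.toLinearMap) ∧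
    IsSumOfFinDim k V (N.carrier ⧸ LinearMap.range f.toLinearMap)

/-- The quotient category `QGr(kQ) = Gr(kQ) / Fdim(kQ)`: the localization of `Gr(kQ)` at the
morphisms whose kernel and cokernel lie in the localizing subcategory `Fdim(kQ)`. -/
abbrev QGr (k : Type u) [Field k] (V : Type v) [Quiver.{w} V] [Fintype V] :=
  (isoModFdim.{u, v, w, t} k V).Localization

/-! ### Veronese quivers -/

/-- The incidence matrix of a quiver with finitely many arrows: the entry `(i, j)` is the number
of arrows from `j` to `i`. -/
def incidenceMatrix (V : Type v) [Quiver.{w} V] : Matrix V V ℕ :=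
  Matrix.of fun i j => Nat.card (j ⟶ i)

/-- The vertices of the `m`-th Veronese `Q^(m)` of a quiver `Q`: the same as those of `Q`. -/
def Veronese (_m : ℕ) (V : Type v) : Type v := V

namespace Veronese

variable {m : ℕ} {V : Type v}

/-- The arrows of `Q^(m)` are the paths of length `m` in `Q`. -/
instance [Quiver.{w} V] : Quiver.{max v w} (Veronese m V) where
  Hom i j := {p : @Quiver.Path V _ i j // p.length = m}

instance [Fintype V] : Fintype (Veronese m V) := inferInstanceAs (Fintype V)

end Veronese

end

-- A graded `kQ`-module splits into the pieces `e_i M_n`, and paths carry pieces to pieces. So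
-- `Gr(kQ)` is equivalent to the category of functors to `k`-modules from the path category of the
-- `ℤ`-covering of `Q`: its objects are pairs `(i, n)`, and its morphisms are the paths whose length
-- is the difference of degrees (`GrMod.toGrRep_isEquivalence`).
--
-- Since `Q` is finite, a module lies in `Fdim` exactly when each element is killed by all
-- sufficiently long paths, provided that the module is graded: a finite-dimensional submodule meets
-- only boundedly many degrees, and conversely finitely many paths span the cyclic submodule. Hence
-- the morphisms to be inverted have a description in terms of functors
-- (`GrMod.isoModFdim_eq_inverseImage`).
--
-- An identification of the arrows of `Q'` with the paths of length `m` in `Q` gives a fully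
-- faithful functor `(i, n) ↦ (i, m n)` of coverings. Restriction along it, the Veronese functor `M
-- ↦ ⨁ M_{mn}`, has the right Kan extension as a fully faithful right adjoint, so it is itself a
-- localization. Every long path passes through degrees divisible by `m`, so a morphism is an
-- isomorphism modulo torsion if and only if its restriction is
-- (`GrRep.isoModTorsion_whiskerLeft_iff`). The two further localizations therefore agree.

universe w'

noncomputable section

/-! ### Localizations and adjunctions -/

section Localization

open Localization

variable {C D : Type*} [Category* C] [Category* D]

/-- If `F` has a fully faithful right adjoint and `W₁` is the inverse image of `W₂` under `F`,
then the localizations at `W₁` and at `W₂` are equivalent. -/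
theorem CategoryTheory.Adjunction.nonempty_localization_equivalence {F : C ⥤ D} {H : D ⥤ C}
    (adj : F ⊣ H) [H.Full] [H.Faithful] (W₁ : MorphismProperty C) (W₂ : MorphismProperty D)
    [W₂.RespectsIso] [W₂.ContainsIdentities] (h : W₁ = W₂.inverseImage F) :
    Nonempty (W₁.Localization ≌ W₂.Localization) := by
  -- As `H` is fully faithful, `F` is the localization at the morphisms that it inverts; it remains
  -- to compose it with the localization at `W₂`.
  have := adj.isLocalization
  have : (F ⋙ W₂.Q).IsLocalization W₁ := by
    refine Functor.IsLocalization.comp F W₂.Q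
      ((MorphismProperty.isomorphisms D).inverseImage F) W₂ W₁ ?_ ?_ ?_
    · intro X Y f hf
      rw [h] at hf
      exact W₂.Q_inverts _ hf
    · intro X Y f (hf : IsIso (F.map f))
      rw [h]
      exact W₂.of_isIso (F.map f)
    · intro X Y g hg
      -- The counit is invertible, so every `g` in `W₂` comes, up to isomorphism, from a morphism of
      -- `W₁`.
      have e : Arrow.mk (F.map (H.map g)) ≅ Arrow.mk g :=
        Arrow.isoMk (asIso (adj.counit.app X)) (asIso (adj.counit.app Y))
          (adj.counit.naturality g).symm
      refine ⟨_, _, H.map g, ?_, ⟨e⟩⟩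
      rw [h]
      exact (W₂.arrow_mk_iso_iff e).2 hg
  exact ⟨uniq W₁.Q (F ⋙ W₂.Q) W₁⟩

end Localization

/-! ### Paths of given length -/

namespace Quiver.Path

variable {V : Type v} [Quiver.{w} V]

/-- The length of the second factor determines where a path is cut, so arrows can be stripped from
the end in parallel. The sigma type is there because the cutting vertices are not known to agree
beforehand. -/
theorem comp_sigma_injective {a b : V} {c c' : V} {p : Path a c} {q : Path c b} {p' : Path a c'}
    {q' : Path c' b} (h : p.comp q = p'.comp q') (hl : q.length = q'.length) :
    (⟨c, p, q⟩ : Σ c, Path a c × Path c b) = ⟨c', p', q'⟩ := by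
  induction q with
  | nil =>
    cases q' with
    | nil => simp_all
    | cons => simp at hl
  | cons q e ih =>
    cases q' with
    | nil => simp at hl
    | cons q' e' =>
      have h1 := obj_eq_of_cons_eq_cons h
      subst h1
      have h2 := eq_of_heq (heq_of_cons_eq_cons h)
      have h3 := eq_of_heq (hom_heq_of_cons_eq_cons h)
      subst h3
      have := ih h2 (by simpa using hl)
      cases this
      rfl

/-- A path of length `n + 1` is a path of length `n` followed by an arrow. -/
def lengthSuccEquiv (a b : V) (n : ℕ) :
    {p : Path a b // p.length = n + 1} ≃ Σ c, {p : Path a c // p.length = n} × (c ⟶ b) where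
  toFun p := match p with
    | ⟨.cons q e, h⟩ => ⟨_, ⟨q, by simpa using h⟩, e⟩
  invFun x := ⟨x.2.1.1.cons x.2.2, by simp [x.2.1.2]⟩
  left_inv p := match p with
    | ⟨.cons q e, h⟩ => rfl
  right_inv x := rfl

instance finite_length [Finite V] [∀ i j : V, Finite (i ⟶ j)] (a b : V) (n : ℕ) :
    Finite {p : Path a b // p.length = n} := by
  induction n generalizing b with
  | zero =>
    have : Subsingleton {p : Path a b // p.length = 0} := by
      refine ⟨fun ⟨p, hp⟩ ⟨q, hq⟩ => ?_⟩
      obtain rfl := eq_of_length_zero p hp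
      simp [eq_nil_of_length_zero p hp, eq_nil_of_length_zero q hq]
    infer_instance
  | succ n ih => exact Finite.of_equiv _ (lengthSuccEquiv a b n).symm

theorem card_length [Fintype V] [DecidableEq V] [∀ i j : V, Finite (i ⟶ j)] (a b : V) (n : ℕ) :
    Nat.card {p : Path a b // p.length = n} = (incidenceMatrix V ^ n) b a := by
  induction n generalizing b with
  | zero =>
    rw [pow_zero, Matrix.one_apply]
    split_ifs with h
    · subst h
      rw [Nat.card_eq_one_iff_unique]
      exact ⟨⟨fun p q => Subtype.ext ((eq_nil_of_length_zero _ p.2).trans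
        (eq_nil_of_length_zero _ q.2).symm)⟩, ⟨⟨nil, rfl⟩⟩⟩
    · rw [Nat.card_eq_zero]
      exact Or.inl ⟨fun p => h (eq_of_length_zero _ p.2).symm⟩
  | succ n ih =>
    rw [Nat.card_congr (lengthSuccEquiv a b n), Nat.card_sigma, pow_succ', Matrix.mul_apply]
    refine Finset.sum_congr rfl fun c _ => ?_
    rw [Nat.card_prod, ih, mul_comm]
    rfl

end Quiver.Path

/-! ### The covering quiver -/

/-- The vertices of the `ℤ`-covering of a quiver. -/
@[ext]
structure CoveringVertex (V : Type v) where
  /-- the underlying vertex -/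
  vertex : V
  /-- the degree -/
  deg : ℤ

namespace CoveringVertex

variable {V : Type v} [Quiver.{w} V]

/-- The path category of the `ℤ`-covering of a quiver: a morphism is a path whose length is the
difference of the degrees. -/
instance : Category.{max v w} (CoveringVertex V) where
  Hom c d := {p : Quiver.Path c.vertex d.vertex // c.deg + p.length = d.deg}
  id c := ⟨.nil, by simp⟩
  comp f g := ⟨f.1.comp g.1, by
    have := f.2
    have := g.2
    rw [Quiver.Path.length_comp]
    omega⟩
  comp_id f := rfl
  id_comp f := Subtype.ext (Quiver.Path.nil_comp f.1)
  assoc f g h := Subtype.ext (Quiver.Path.comp_assoc f.1 g.1 h.1)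

theorem hom_ext {c d : CoveringVertex V} {f g : c ⟶ d} (h : f.1 = g.1) : f = g := Subtype.ext h

theorem exists_fac {c d : CoveringVertex V} (f : c ⟶ d) (n : ℤ) (h₁ : c.deg ≤ n)
    (h₂ : n ≤ d.deg) :
    ∃ (i : V) (g : c ⟶ ⟨i, n⟩) (g' : (⟨i, n⟩ : CoveringVertex V) ⟶ d), f = g ≫ g' := by
  have hf := f.2
  obtain ⟨i, p, q, hpq, hp⟩ := f.1.exists_eq_comp_of_le_length (n := (n - c.deg).toNat) (by omega)
  refine ⟨i, ⟨p, by dsimp only; omega⟩, ⟨q, ?_⟩, hom_ext hpq⟩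
  rw [hpq, Quiver.Path.length_comp] at hf
  dsimp only
  omega

instance [Finite V] [∀ i j : V, Finite (i ⟶ j)] (c d : CoveringVertex V) : Finite (c ⟶ d) :=
  Finite.of_injective
    (fun f => (⟨f.1, by have := f.2; omega⟩ :
      {p : Quiver.Path c.vertex d.vertex // p.length = (d.deg - c.deg).toNat}))
    fun f g h => hom_ext (Subtype.mk.inj h)

end CoveringVertex

/-- The graded representations of a quiver. -/
abbrev GrRep (k : Type u) [Field k] (V : Type v) [Quiver.{w} V] :=
  CoveringVertex V ⥤ ModuleCat.{t} k

namespace GrRep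

variable {k : Type u} [Field k] {V : Type v} [Quiver.{w} V]

/-- The morphisms of graded representations such that every element of the kernel and of the
cokernel is killed by all sufficiently long paths. -/
def isoModTorsion (k : Type u) [Field k] (V : Type v) [Quiver.{w} V] :
    MorphismProperty (GrRep.{u, v, w, t} k V) := fun M N f =>
  (∀ c (x : M.obj c), f.app c x = 0 →
    ∃ n : ℤ, ∀ d (g : c ⟶ d), n ≤ d.deg → M.map g x = 0) ∧
  (∀ c (y : N.obj c), ∃ n : ℤ, ∀ d (g : c ⟶ d), n ≤ d.deg → ∃ x, f.app d x = N.map g y)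

theorem naturality_apply {M N : GrRep.{u, v, w, t} k V} (f : M ⟶ N) {c d : CoveringVertex V}
    (g : c ⟶ d) (x : M.obj c) : f.app d (M.map g x) = N.map g (f.app c x) :=
  congr($(f.naturality g) x)

theorem inv_hom_app_apply {M N : GrRep.{u, v, w, t} k V} (e : M ≅ N) (c : CoveringVertex V)
    (x : N.obj c) : e.hom.app c (e.inv.app c x) = x :=
  congr($(e.inv_hom_id_app c) x)

theorem hom_inv_app_apply {M N : GrRep.{u, v, w, t} k V} (e : M ≅ N) (c : CoveringVertex V)
    (x : M.obj c) : e.inv.app c (e.hom.app c x) = x :=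
  congr($(e.hom_inv_id_app c) x)

instance : (isoModTorsion.{u, v, w, t} k V).RespectsIso := by
  refine MorphismProperty.RespectsIso.mk _ ?_ ?_
  · intro M M' N e f hf
    refine ⟨fun c x hx => ?_, fun c y => ?_⟩
    · obtain ⟨n, hn⟩ := hf.1 c (e.hom.app c x) hx
      refine ⟨n, fun d g hd => ?_⟩
      rw [← hom_inv_app_apply e d (M.map g x), naturality_apply, hn d g hd, map_zero]
    · obtain ⟨n, hn⟩ := hf.2 c y
      refine ⟨n, fun d g hd => ?_⟩
      obtain ⟨x, hx⟩ := hn d g hd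
      refine ⟨e.inv.app d x, ?_⟩
      rw [← hx]
      exact congrArg (f.app d) (inv_hom_app_apply e d x)
  · intro M N N' e f hf
    refine ⟨fun c x hx => hf.1 c x ?_, fun c y => ?_⟩
    · rw [← hom_inv_app_apply e c (f.app c x)]
      exact (congrArg (e.inv.app c) hx).trans (map_zero _)
    · obtain ⟨n, hn⟩ := hf.2 c (e.inv.app c y)
      refine ⟨n, fun d g hd => ?_⟩
      obtain ⟨x, hx⟩ := hn d g hd
      refine ⟨x, ?_⟩
      refine (congrArg (e.hom.app d) hx).trans ?_
      rw [naturality_apply, inv_hom_app_apply]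

instance : (isoModTorsion.{u, v, w, t} k V).ContainsIdentities where
  id_mem M := ⟨fun c x hx => ⟨0, fun d g _ => by rw [show x = 0 from hx, map_zero]⟩,
    fun c y => ⟨0, fun d g _ => ⟨_, rfl⟩⟩⟩

end GrRep

/-! ### The Veronese functor -/

/-- An identification of the arrows of a quiver `V'` with the paths of length `m` of `V`. -/
structure VeroneseData (m : ℕ) (V : Type v) [Quiver.{w} V] (V' : Type*) [Quiver V'] where
  /-- the identification of the vertices -/
  vertexEquiv : V' ≃ V
  /-- the identification of the arrows with the paths of length `m` -/
  homEquiv (i j : V') :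
    (i ⟶ j) ≃ {p : Quiver.Path (vertexEquiv i) (vertexEquiv j) // p.length = m}

namespace VeroneseData

variable {m : ℕ} {V : Type v} [Quiver.{w} V] {V' : Type*} [Quiver V'] (E : VeroneseData m V V')

/-- The path of `V` underlying a path of the Veronese quiver. -/
def expand {i : V'} : ∀ {j : V'}, Quiver.Path i j → Quiver.Path (E.vertexEquiv i) (E.vertexEquiv j)
  | _, .nil => .nil
  | _, .cons p a => (expand p).comp (E.homEquiv _ _ a).1

theorem expand_comp {i j l : V'} (p : Quiver.Path i j) (q : Quiver.Path j l) :
    E.expand (p.comp q) = (E.expand p).comp (E.expand q) := by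
  induction q with
  | nil => rfl
  | cons q a ih => simp [expand, ih]

theorem length_expand {i j : V'} (p : Quiver.Path i j) :
    (E.expand p).length = m * p.length := by
  induction p with
  | nil => rfl
  | cons p a ih => simp [expand, ih, (E.homEquiv _ _ a).2, mul_add]

theorem expand_injective {i j : V'} {p q : Quiver.Path i j} (hl : p.length = q.length)
    (h : E.expand p = E.expand q) : p = q := by
  induction p with
  | nil => exact (Quiver.Path.eq_nil_of_length_zero q hl.symm).symm
  | @cons b _ p a ih =>
    cases q with
    | nil => simp at hl
    | @cons b' _ q a' =>
      have key := Quiver.Path.comp_sigma_injective h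
        ((E.homEquiv _ _ a).2.trans (E.homEquiv _ _ a').2.symm)
      have hb := E.vertexEquiv.injective (congrArg Sigma.fst key)
      subst hb
      have key' := eq_of_heq (Sigma.mk.inj key).2
      rw [ih (by simpa using hl) (congrArg Prod.fst key'),
        (E.homEquiv _ _).injective (Subtype.ext (congrArg Prod.snd key'))]

/-- A path of length `m * n` is cut into blocks of length `m`, each of which is an arrow of the
Veronese quiver. -/
theorem exists_expand_eq {i : V'} (n : ℕ) : ∀ {j : V'}
    (p : Quiver.Path (E.vertexEquiv i) (E.vertexEquiv j)), p.length = m * n →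
      ∃ q : Quiver.Path i j, q.length = n ∧ E.expand q = p := by
  induction n with
  | zero =>
    intro j p hp
    obtain rfl := E.vertexEquiv.injective (p.eq_of_length_zero hp)
    exact ⟨.nil, rfl, (p.eq_nil_of_length_zero hp).symm⟩
  | succ n ih =>
    intro j p hp
    obtain ⟨l, p₁, p₂, rfl, hp₁⟩ :=
      p.exists_eq_comp_of_le_length (n := m * n) (by rw [hp]; gcongr; omega)
    obtain ⟨l, rfl⟩ := E.vertexEquiv.surjective l
    obtain ⟨q, hq, rfl⟩ := ih p₁ hp₁
    refine ⟨q.cons ((E.homEquiv _ _).symm ⟨p₂, ?_⟩), by simp [hq], by simp [expand]⟩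
    rw [Quiver.Path.length_comp, hp₁, mul_add] at hp
    omega

/-- The functor between the coverings that multiplies the degrees by `m`. -/
@[simps obj]
def functor : CoveringVertex V' ⥤ CoveringVertex V where
  obj c := ⟨E.vertexEquiv c.vertex, m * c.deg⟩
  map f := ⟨E.expand f.1, by
    dsimp only
    rw [E.length_expand, Nat.cast_mul, ← mul_add]
    exact congrArg _ f.2⟩
  map_comp f g := Subtype.ext (E.expand_comp f.1 g.1)

theorem functor_faithful : E.functor.Faithful where
  map_injective {c d} f g h := CoveringVertex.hom_ext <| E.expand_injective
    (by have := f.2; have := g.2; omega) (congrArg Subtype.val h)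

/-- A path between degrees `m * c.deg` and `m * d.deg` has length `m * (d.deg - c.deg)`, and `m > 0`
forces `c.deg ≤ d.deg`; so it is an expansion. -/
theorem functor_full (hm : 1 ≤ m) : E.functor.Full where
  map_surjective {c d} f := by
    have hf : m * c.deg + f.1.length = m * d.deg := f.2
    have hle : c.deg ≤ d.deg := by
      by_contra! h
      have : (m : ℤ) * d.deg < m * c.deg := by
        apply mul_lt_mul_of_pos_left h
        exact_mod_cast hm
      omega
    obtain ⟨n, hn⟩ := Int.le.dest hle
    obtain ⟨q, hq, hq'⟩ := E.exists_expand_eq n f.1 (by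
      rw [← hn, mul_add] at hf
      have := add_left_cancel hf
      exact_mod_cast this)
    exact ⟨⟨q, by rw [hq, hn]⟩, CoveringVertex.hom_ext hq'⟩

/-- The path is cut in degrees `m * q` and `m * max n q`; its middle section joins two vertices in
the image of `E.functor`, so it lifts by fullness. The maximum keeps the second cut from preceding
the first. -/
theorem exists_fac_functor (hm : 1 ≤ m) {c : CoveringVertex V} (q n : ℤ) (hq : c.deg ≤ m * q)
    {d : CoveringVertex V} (g : c ⟶ d) (hd : m * (max n q + 1) ≤ d.deg) :
    ∃ (b b' : CoveringVertex V') (g₁ : c ⟶ E.functor.obj b) (g₂ : b ⟶ b')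
      (g₃ : E.functor.obj b' ⟶ d), g = g₁ ≫ E.functor.map g₂ ≫ g₃ ∧ b.deg = q ∧ n ≤ b'.deg := by
  have hm' : (1 : ℤ) ≤ m := by exact_mod_cast hm
  have := E.functor_full hm
  have h₁ : m * q ≤ m * max n q := by gcongr; exact le_max_right _ _
  have h₂ : m * max n q ≤ d.deg := le_trans (by gcongr; omega) hd
  obtain ⟨i, g₁, g', rfl⟩ := CoveringVertex.exists_fac g (m * q) hq (h₁.trans h₂)
  obtain ⟨j, g₂, g₃, rfl⟩ := CoveringVertex.exists_fac g' (m * max n q) h₁ h₂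
  obtain ⟨i, rfl⟩ := E.vertexEquiv.surjective i
  obtain ⟨j, rfl⟩ := E.vertexEquiv.surjective j
  obtain ⟨g₂, rfl⟩ := E.functor.map_surjective
    (show E.functor.obj ⟨i, q⟩ ⟶ E.functor.obj ⟨j, max n q⟩ from g₂)
  exact ⟨⟨i, q⟩, ⟨j, max n q⟩, g₁, g₂, g₃, rfl, rfl, le_max_left _ _⟩

end VeroneseData

namespace GrRep

variable {k : Type u} [Field k] {V V' : Type v} [Quiver.{w} V] [Quiver.{w'} V'] {m : ℕ}

/-- A morphism of graded representations is an isomorphism modulo torsion if and only if its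
restriction along the Veronese functor is one. -/
theorem isoModTorsion_whiskerLeft_iff [Finite V'] [∀ i j : V, Finite (i ⟶ j)]
    (E : VeroneseData m V V') (hm : 1 ≤ m) {M N : GrRep.{u, v, w, t} k V} (f : M ⟶ N) :
    isoModTorsion k V' (Functor.whiskerLeft E.functor f) ↔ isoModTorsion k V f := by
  have : Finite V := Finite.of_equiv _ E.vertexEquiv
  have hm' : (1 : ℤ) ≤ m := by exact_mod_cast hm
  -- The maximum with `0` is needed because `c.deg ≤ m * c.deg` can fail in negative degrees.
  have hbound (c : CoveringVertex V) : c.deg ≤ m * max c.deg 0 :=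
    (le_max_left _ 0).trans (le_mul_of_one_le_left (le_max_right _ _) hm')
  constructor
  · rintro ⟨h₁, h₂⟩
    refine ⟨fun c x hx => ?_, fun c y => ?_⟩
    -- Only finitely many paths lead from `c` to degree `m * max c.deg 0`. Each gives a bound after
    -- which its image of `x` dies, and a common bound `n` serves all of them.
    · choose F hF using fun (b : Σ i : V', c ⟶ E.functor.obj ⟨i, max c.deg 0⟩) =>
        h₁ ⟨b.1, max c.deg 0⟩ (M.map b.2 x) (by
          refine (naturality_apply f b.2 x).trans ?_
          rw [hx, map_zero])
      obtain ⟨n, hn⟩ := (Set.finite_range F).bddAbove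
      refine ⟨m * (max n (max c.deg 0) + 1), fun d g hd => ?_⟩
      obtain ⟨⟨i, q⟩, b', g₁, g₂, g₃, rfl, rfl, hb'⟩ :=
        E.exists_fac_functor hm _ n (hbound c) g hd
      have := hF ⟨i, g₁⟩ b' g₂ ((hn ⟨_, rfl⟩).trans hb')
      simp only [Functor.map_comp, ModuleCat.comp_apply]
      exact (congrArg (M.map g₃) this).trans (map_zero _)
    · choose F hF using fun (b : Σ i : V', c ⟶ E.functor.obj ⟨i, max c.deg 0⟩) =>
        h₂ ⟨b.1, max c.deg 0⟩ (N.map b.2 y)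
      obtain ⟨n, hn⟩ := (Set.finite_range F).bddAbove
      refine ⟨m * (max n (max c.deg 0) + 1), fun d g hd => ?_⟩
      obtain ⟨⟨i, q⟩, b', g₁, g₂, g₃, rfl, rfl, hb'⟩ :=
        E.exists_fac_functor hm _ n (hbound c) g hd
      obtain ⟨x, hx⟩ := hF ⟨i, g₁⟩ b' g₂ ((hn ⟨_, rfl⟩).trans hb')
      -- A preimage found at `b'` is transported along the remaining path `g₃`.
      refine ⟨M.map g₃ x, ?_⟩
      simp only [Functor.map_comp, ModuleCat.comp_apply, naturality_apply]
      exact congrArg (N.map g₃) hx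
  · have hdeg (n : ℤ) (d : CoveringVertex V') (hd : max n 0 ≤ d.deg) :
        n ≤ (E.functor.obj d).deg :=
      ((le_max_left _ 0).trans hd).trans
        (le_mul_of_one_le_left ((le_max_right n 0).trans hd) hm')
    rintro ⟨h₁, h₂⟩
    refine ⟨fun c x hx => ?_, fun c y => ?_⟩
    · obtain ⟨n, hn⟩ := h₁ _ x hx
      exact ⟨max n 0, fun d g hd => hn _ (E.functor.map g) (hdeg n d hd)⟩
    · obtain ⟨n, hn⟩ := h₂ _ y
      exact ⟨max n 0, fun d g hd => hn _ (E.functor.map g) (hdeg n d hd)⟩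

/-- Right Kan extension along a fully faithful functor restricts back to the original functor, so
the counit is invertible and the right adjoint is fully faithful. The module universe is large
enough for the limits that compute this extension. -/
theorem nonempty_localization_equivalence [Finite V'] [∀ i j : V, Finite (i ⟶ j)]
    (E : VeroneseData m V V') (hm : 1 ≤ m) :
    Nonempty ((isoModTorsion.{u, v, w, max v w w' t} k V).Localization ≌
      (isoModTorsion.{u, v, w', max v w w' t} k V').Localization) := by
  have := E.functor_full hm
  have := E.functor_faithful
  have : Limits.HasLimitsOfSize.{max v w', max v w w'} (ModuleCat.{max v w w' t} k) :=
    ModuleCat.hasLimitsOfSize.{max v w', max v w w', max v w w' t, u}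
  have adj := E.functor.ranAdjunction (ModuleCat.{max v w w' t} k)
  have hff := (E.functor.ranAdjunction (ModuleCat.{max v w w' t} k)).fullyFaithfulROfIsIsoCounit
  have := hff.full
  have := hff.faithful
  refine adj.nonempty_localization_equivalence _ _ ?_
  ext M N f
  exact (isoModTorsion_whiskerLeft_iff E hm f).symm

end GrRep

/-! ### Graded modules and graded representations -/

open PathAlgebra

namespace PathAlgebra

variable {k : Type u} [Field k] {V : Type v} [Quiver.{w} V]

variable (k) in
theorem ofPath_mem_degree (p : QuiverPath V) : ofPath k p ∈ degree k V p.length :=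
  Submodule.subset_span ⟨p, rfl, rfl⟩

variable (k) in
/-- The element of the path algebra given by a morphism of the covering. -/
abbrev ofHom {c d : CoveringVertex V} (g : c ⟶ d) : PathAlgebra k V :=
  ofPath k ⟨c.vertex, d.vertex, g.1⟩

variable (k) in
/-- The idempotent of the path algebra given by a vertex. -/
abbrev idem (i : V) : PathAlgebra k V := ofPath k (QuiverPath.nil i)

theorem ofHom_id (c : CoveringVertex V) : ofHom k (𝟙 c) = idem k c.vertex := rfl

theorem ofHom_comp {c d e : CoveringVertex V} (f : c ⟶ d) (g : d ⟶ e) :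
    ofHom k (f ≫ g) = ofHom k g * ofHom k f :=
  (ofPath_mul_comp g.1 f.1).symm

theorem idem_mul_idem (i : V) : idem k i * idem k i = idem k i :=
  ofPath_mul_comp Quiver.Path.nil Quiver.Path.nil

theorem ofPath_mul_idem_of_ne {p : QuiverPath V} {i : V} (h : i ≠ p.src) :
    ofPath k p * idem k i = 0 :=
  ofPath_mul_eq_zero (q := QuiverPath.nil i) h

end PathAlgebra

namespace GrMod

variable {k : Type u} [Field k] {V : Type v} [Quiver.{w} V] [Fintype V]

instance (M : GrMod.{u, v, w, t} k V) : DirectSum.Decomposition M.gr :=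
  M.isInternal.chooseDecomposition

variable (M : GrMod.{u, v, w, t} k V)

/-- The part of a graded module that lies over a vertex of the covering. -/
def piece (c : CoveringVertex V) : Submodule k M.carrier where
  carrier := {x | x ∈ M.gr c.deg ∧ idem k c.vertex • x = x}
  add_mem' hx hy := ⟨add_mem hx.1 hy.1, by rw [smul_add, hx.2, hy.2]⟩
  zero_mem' := ⟨zero_mem _, smul_zero _⟩
  smul_mem' a x hx := ⟨Submodule.smul_mem _ a hx.1, by rw [smul_comm, hx.2]⟩

variable {M}

theorem idem_smul_mem {n : ℤ} {x : M.carrier} (hx : x ∈ M.gr n) (i : V) :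
    idem k i • x ∈ M.gr n := by
  simpa using M.smul_mem 0 n _ x (ofPath_mem_degree k (QuiverPath.nil i)) hx

theorem idem_smul_mem_piece {n : ℤ} {x : M.carrier} (hx : x ∈ M.gr n) (i : V) :
    idem k i • x ∈ M.piece ⟨i, n⟩ :=
  ⟨idem_smul_mem hx i, by rw [← mul_smul, idem_mul_idem]⟩

theorem ofHom_smul_mem {c d : CoveringVertex V} (g : c ⟶ d) {x : M.carrier}
    (hx : x ∈ M.piece c) : ofHom k g • x ∈ M.piece d := by
  refine ⟨?_, ?_⟩
  · have h := M.smul_mem g.1.length c.deg (ofHom k g) x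
      (ofPath_mem_degree k ⟨c.vertex, d.vertex, g.1⟩) hx.1
    have hg : (g.1.length : ℤ) + c.deg = d.deg := (add_comm _ _).trans g.2
    rwa [hg] at h
  · rw [← ofHom_id, ← mul_smul, ← ofHom_comp, Category.comp_id]

theorem ofPath_smul_eq_zero {c : CoveringVertex V} {x : M.carrier} (hx : x ∈ M.piece c)
    {p : QuiverPath V} (h : c.vertex ≠ p.src) : ofPath k p • x = 0 := by
  rw [← hx.2, ← mul_smul, ofPath_mul_idem_of_ne h, zero_smul]

theorem sum_idem_smul (x : M.carrier) : ∑ i : V, idem k i • x = x := by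
  rw [← Finset.sum_smul, ← one_def, one_smul]

/-- Induction on the elements of a graded module. -/
theorem piece_induction {P : M.carrier → Prop} (x : M.carrier) (h0 : P 0)
    (hadd : ∀ x y, P x → P y → P (x + y)) (hp : ∀ c, ∀ x ∈ M.piece c, P x) : P x := by
  refine DirectSum.Decomposition.inductionOn M.gr h0 (fun {n} x => ?_) hadd x
  rw [← sum_idem_smul x.1]
  exact Finset.sum_induction _ P hadd h0 fun i _ => hp _ _ (idem_smul_mem_piece x.2 i)

theorem coe_decompose_map {N : GrMod.{u, v, w, t} k V} (f : M ⟶ N) (x : M.carrier) (n : ℤ) :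
    f.toLinearMap (DirectSum.decompose M.gr x n) =
      DirectSum.decompose N.gr (f.toLinearMap x) n := by
  refine DirectSum.Decomposition.inductionOn M.gr ?_ ?_ ?_ x
  · simp
  · intro i y
    by_cases h : i = n
    · subst h
      rw [DirectSum.decompose_of_mem_same _ y.2,
        DirectSum.decompose_of_mem_same _ (f.map_mem _ _ y.2)]
    · rw [DirectSum.decompose_of_mem_ne _ y.2 h,
        DirectSum.decompose_of_mem_ne _ (f.map_mem _ _ y.2) h, map_zero]
  · intro y z hy hz
    simp [hy, hz]

/-- The elements of a kernel are sums of homogeneous elements of the kernel. -/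
theorem ker_induction {N : GrMod.{u, v, w, t} k V} (f : M ⟶ N) {P : M.carrier → Prop}
    (x : M.carrier) (hx : f.toLinearMap x = 0) (h0 : P 0) (hadd : ∀ x y, P x → P y → P (x + y))
    (hp : ∀ c, ∀ x ∈ M.piece c, f.toLinearMap x = 0 → P x) : P x := by
  classical
  rw [← DirectSum.sum_support_decompose M.gr x]
  refine Finset.sum_induction _ P hadd h0 fun n _ => ?_
  rw [← sum_idem_smul ((DirectSum.decompose M.gr x n : M.carrier))]
  refine Finset.sum_induction _ P hadd h0 fun i _ => hp _ _
    (idem_smul_mem_piece (DirectSum.decompose M.gr x n).2 i) ?_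
  rw [map_smul, coe_decompose_map, hx, DirectSum.decompose_zero]
  simp

theorem Hom.map_mem_piece {M N : GrMod.{u, v, w, t} k V} (f : M ⟶ N) {c : CoveringVertex V}
    {x : M.carrier} (hx : x ∈ M.piece c) : f.toLinearMap x ∈ N.piece c :=
  ⟨f.map_mem _ _ hx.1, by rw [← map_smul, hx.2]⟩

variable (k V) in
/-- The functor from graded modules over the path algebra to graded representations. -/
def toGrRep : GrMod.{u, v, w, t} k V ⥤ GrRep.{u, v, w, t} k V where
  obj M :=
    { obj c := ModuleCat.of k (M.piece c)
      map g := ModuleCat.ofHom ((DistribSMul.toLinearMap k M.carrier (ofHom k g)).restrict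
        fun _ hx => ofHom_smul_mem g hx)
      map_id c := by
        ext x
        exact x.2.2
      map_comp f g := by
        ext x
        change ofHom k (f ≫ g) • x.1 = ofHom k g • ofHom k f • x.1
        rw [ofHom_comp, mul_smul] }
  map f :=
    { app c := ModuleCat.ofHom ((f.toLinearMap.restrictScalars k).restrict
        fun _ hx => Hom.map_mem_piece f hx)
      naturality c d g := by
        ext x
        exact map_smul f.toLinearMap (ofHom k g) x.1 }

instance : (toGrRep.{u, v, w, t} k V).Faithful where
  map_injective {M N f g} h := by
    refine Hom.ext (LinearMap.ext fun x => ?_)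
    induction x using piece_induction with
    | h0 => simp
    | hadd x y hx hy => simp [hx, hy]
    | hp c x hx =>
      exact congrArg (fun α : (toGrRep k V).obj M ⟶ (toGrRep k V).obj N =>
        (α.app c ⟨x, hx⟩ : N.piece c).1) h

section Full

variable {M N : GrMod.{u, v, w, t} k V} (α : (toGrRep k V).obj M ⟶ (toGrRep k V).obj N)

/-- The linear map underlying the morphism of graded modules given by a morphism of graded
representations. -/
def liftLinearMap : M.carrier →ₗ[k] N.carrier :=
  DirectSum.toModule k ℤ N.carrier (fun n => ∑ i : V,
    (N.piece ⟨i, n⟩).subtype ∘ₗ (α.app ⟨i, n⟩).hom ∘ₗ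
      ((DistribSMul.toLinearMap k M.carrier (idem k i)).restrict
        (p := M.gr n) (q := M.piece ⟨i, n⟩) fun _ hx => idem_smul_mem_piece hx i)) ∘ₗ
    (DirectSum.decomposeLinearEquiv M.gr).toLinearMap

theorem liftLinearMap_apply {c : CoveringVertex V} (x : M.piece c) :
    liftLinearMap α x.1 = (α.app c x : N.piece c).1 := by
  classical
  obtain ⟨i, n⟩ := c
  obtain ⟨x, hx⟩ := x
  have h : DirectSum.decomposeLinearEquiv M.gr x = DirectSum.lof k ℤ (fun n => M.gr n) n ⟨x, hx.1⟩ :=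
    DirectSum.decompose_of_mem _ hx.1
  rw [liftLinearMap, LinearMap.comp_apply, LinearEquiv.coe_coe, h, DirectSum.toModule_lof,
    LinearMap.sum_apply, Finset.sum_eq_single i]
  · have h' : (DistribSMul.toLinearMap k M.carrier (idem k i)).restrict
        (p := M.gr n) (q := M.piece ⟨i, n⟩) (fun _ hx => idem_smul_mem_piece hx i) ⟨x, hx.1⟩ =
        ⟨x, hx⟩ := Subtype.ext hx.2
    exact congrArg (fun y => (α.app ⟨i, n⟩ y : N.piece ⟨i, n⟩).1) h'
  · intro j _ hj
    have h' : (DistribSMul.toLinearMap k M.carrier (idem k j)).restrict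
        (p := M.gr n) (q := M.piece ⟨j, n⟩) (fun _ hx => idem_smul_mem_piece hx j) ⟨x, hx.1⟩ =
        0 := Subtype.ext (ofPath_smul_eq_zero hx hj.symm)
    refine (congrArg (fun y => (α.app ⟨j, n⟩ y : N.piece ⟨j, n⟩).1) h').trans ?_
    exact congrArg Subtype.val (map_zero (α.app ⟨j, n⟩).hom)
  · simp

/-- By linearity it suffices to let a path act on an element of one piece: if the path starts at the
vertex of that piece this is naturality of `α`, and otherwise both sides vanish. -/
theorem liftLinearMap_smul (a : PathAlgebra k V) (x : M.carrier) :
    liftLinearMap α (a • x) = a • liftLinearMap α x := by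
  induction x using piece_induction with
  | h0 => simp
  | hadd x y hx hy => simp [hx, hy]
  | hp c x hx =>
    have hα : liftLinearMap α x ∈ N.piece c := by
      rw [liftLinearMap_apply α ⟨x, hx⟩]
      exact Subtype.property _
    induction a using PathAlgebra.induct with
    | h0 => simp
    | hadd a b ha hb => simp [add_smul, ha, hb]
    | hs r p =>
      rw [smul_assoc, smul_assoc, map_smul]
      congr 1
      by_cases h : c.vertex = p.src
      · obtain ⟨i, n⟩ := c
        obtain ⟨i, j, p⟩ := p
        subst h
        let g : (⟨i, n⟩ : CoveringVertex V) ⟶ ⟨j, n + p.length⟩ := ⟨p, rfl⟩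
        refine (liftLinearMap_apply α ⟨_, ofHom_smul_mem g hx⟩).trans ?_
        rw [liftLinearMap_apply α ⟨x, hx⟩]
        exact congrArg Subtype.val (GrRep.naturality_apply α g ⟨x, hx⟩)
      · rw [ofPath_smul_eq_zero hx h, ofPath_smul_eq_zero hα h, map_zero]

instance : (toGrRep.{u, v, w, t} k V).Full where
  map_surjective {M N} α := by
    refine ⟨{ toLinearMap := { liftLinearMap α with map_smul' := liftLinearMap_smul α }
              map_mem n x hx := ?_ }, ?_⟩
    · change liftLinearMap α x ∈ _
      rw [← sum_idem_smul x, map_sum]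
      refine Submodule.sum_mem _ fun i _ => ?_
      rw [liftLinearMap_apply α ⟨_, idem_smul_mem_piece hx i⟩]
      exact (Subtype.property (p := (· ∈ N.piece ⟨i, n⟩)) _).1
    · ext c x
      exact Subtype.ext (liftLinearMap_apply α x)

end Full

end GrMod

/-! ### The total space of a graded representation -/

theorem Quiver.Path.length_cast_left {V : Type v} [Quiver.{w} V] {a a' b : V} (h : a = a')
    (p : Quiver.Path a b) : (p.cast h rfl).length = p.length := by
  subst h
  rfl

namespace GrRep

variable {k : Type u} [Field k] {V : Type v} [Quiver.{w} V]

/-- The direct sum of all components of a graded representation. -/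
def Total (M : GrRep.{u, v, w, t} k V) : Type (max v t) :=
  DirectSum (CoveringVertex V) fun c => M.obj c

namespace Total

variable (M : GrRep.{u, v, w, t} k V)

instance : AddCommGroup (Total M) :=
  inferInstanceAs (AddCommGroup (DirectSum (CoveringVertex V) fun c => M.obj c))

instance : Module k (Total M) :=
  inferInstanceAs (Module k (DirectSum (CoveringVertex V) fun c => M.obj c))

open Classical in
/-- The inclusion of a component. -/
def of (c : CoveringVertex V) : M.obj c →ₗ[k] Total M :=
  DirectSum.lof k (CoveringVertex V) (fun c => M.obj c) c

/-- The projection to a component. -/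
def proj (c : CoveringVertex V) : Total M →ₗ[k] M.obj c :=
  DirectSum.component k (CoveringVertex V) (fun c => M.obj c) c

open Classical in
/-- The linear map out of the total space given by linear maps out of the components. -/
def desc {N : Type*} [AddCommGroup N] [Module k N] (f : ∀ c, M.obj c →ₗ[k] N) :
    Total M →ₗ[k] N :=
  DirectSum.toModule k (CoveringVertex V) N f

variable {M}

@[simp]
theorem desc_of {N : Type*} [AddCommGroup N] [Module k N] (f : ∀ c, M.obj c →ₗ[k] N)
    (c : CoveringVertex V) (x : M.obj c) : desc M f (of M c x) = f c x := by
  classical exact DirectSum.toModule_lof (M := fun c => M.obj c) k c x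

@[simp]
theorem proj_of_same (c : CoveringVertex V) (x : M.obj c) : proj M c (of M c x) = x := by
  classical exact DirectSum.component.lof_self (M := fun c => M.obj c) k c x

theorem proj_of_ne {c d : CoveringVertex V} (h : c ≠ d) (x : M.obj c) :
    proj M d (of M c x) = 0 := by
  classical exact (DirectSum.component.of (M := fun c => M.obj c) k d c x).trans (dif_neg h)

theorem ext {x y : Total M} (h : ∀ c, proj M c x = proj M c y) : x = y :=
  DFinsupp.ext h

theorem induction {P : Total M → Prop} (x : Total M) (h0 : P 0)
    (hadd : ∀ x y, P x → P y → P (x + y)) (hof : ∀ c y, P (of M c y)) : P x := by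
  classical exact DirectSum.induction_on x h0 hof hadd

variable (M) in
open Classical in
/-- The action of a path on the total space. -/
def pathAct (p : QuiverPath V) : Total M →ₗ[k] Total M :=
  desc M fun c => if h : c.vertex = p.src then
    of M ⟨p.tgt, c.deg + p.length⟩ ∘ₗ
      (M.map (Y := ⟨p.tgt, c.deg + p.length⟩) ⟨p.path.cast h.symm rfl, by
        rw [Quiver.Path.length_cast_left]
        rfl⟩).hom else 0

theorem pathAct_of {c d : CoveringVertex V} (g : c ⟶ d) (x : M.obj c) :
    pathAct M ⟨c.vertex, d.vertex, g.1⟩ (of M c x) = of M d (M.map g x) := by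
  -- `pathAct` lands in degree `c.deg + p.length`, which equals `d.deg` only propositionally; a free
  -- target degree `n` can be substituted.
  have key {j : V} {n : ℤ} (p : Quiver.Path c.vertex j) (hp : c.deg + p.length = n) :
      pathAct M ⟨c.vertex, j, p⟩ (of M c x) = of M ⟨j, n⟩ (M.map (Y := ⟨j, n⟩) ⟨p, hp⟩ x) := by
    subst hp
    rw [pathAct, desc_of, dif_pos rfl]
    rfl
  exact key g.1 g.2

theorem pathAct_of_ne {c : CoveringVertex V} {p : QuiverPath V} (h : c.vertex ≠ p.src)
    (x : M.obj c) : pathAct M p (of M c x) = 0 := by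
  rw [pathAct, desc_of, dif_neg h, LinearMap.zero_apply]

variable (M) in
/-- The action of the path algebra on the total space. -/
def act : PathAlgebra k V →ₗ[k] Total M →ₗ[k] Total M :=
  Finsupp.linearCombination k (pathAct M)

theorem act_ofPath (p : QuiverPath V) : act M (ofPath k p) = pathAct M p :=
  (Finsupp.linearCombination_single k _ _).trans (one_smul _ _)

theorem act_ofHom {c d : CoveringVertex V} (g : c ⟶ d) (x : M.obj c) :
    act M (ofHom k g) (of M c x) = of M d (M.map g x) := by
  rw [act_ofPath, pathAct_of]

theorem act_idem_of (c : CoveringVertex V) (x : M.obj c) :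
    act M (idem k c.vertex) (of M c x) = of M c x := by
  rw [← ofHom_id, act_ofHom, M.map_id]
  rfl

theorem act_one [Fintype V] (x : Total M) : act M 1 x = x := by
  classical
  induction x using induction with
  | h0 => simp
  | hadd x y hx hy => simp [hx, hy]
  | hof c x =>
    rw [one_def, map_sum, LinearMap.sum_apply, Finset.sum_eq_single c.vertex]
    · exact act_idem_of c x
    · intro i _ hi
      rw [act_ofPath, pathAct_of_ne]
      exact hi.symm
    · simp

theorem act_ofPath_mul (p q : QuiverPath V) (x : Total M) :
    act M (ofPath k p * ofPath k q) x = act M (ofPath k p) (act M (ofPath k q) x) := by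
  induction x using induction with
  | h0 => simp
  | hadd x y hx hy => simp [hx, hy]
  | hof c x =>
    by_cases h : c.vertex = q.src
    · obtain ⟨i, n⟩ := c
      obtain ⟨i', j, q⟩ := q
      subst h
      let g : (⟨i, n⟩ : CoveringVertex V) ⟶ ⟨j, n + q.length⟩ := ⟨q, rfl⟩
      change act M (ofPath k p * ofHom k g) _ = act M _ (act M (ofHom k g) _)
      rw [act_ofHom]
      by_cases h' : j = p.src
      · obtain ⟨j', l, p⟩ := p
        subst h'
        let g' : (⟨j, n + q.length⟩ : CoveringVertex V) ⟶ ⟨l, n + q.length + p.length⟩ := ⟨p, rfl⟩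
        change act M (ofHom k g' * ofHom k g) _ = act M (ofHom k g') _
        rw [← ofHom_comp, act_ofHom, act_ofHom, M.map_comp]
        rfl
      · rw [ofPath_mul_eq_zero h', act_ofPath, pathAct_of_ne h', map_zero, LinearMap.zero_apply]
    · rw [act_ofPath q, pathAct_of_ne h, map_zero]
      by_cases h' : q.tgt = p.src
      · rw [ofPath_mul_ofPath, pathMul, dif_pos h', act_ofPath]
        exact pathAct_of_ne (p := ⟨q.src, p.tgt, _⟩) h x
      · rw [ofPath_mul_eq_zero h', map_zero, LinearMap.zero_apply]

theorem act_mul [Fintype V] (a b : PathAlgebra k V) (x : Total M) :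
    act M (a * b) x = act M a (act M b x) := by
  induction a using PathAlgebra.induct with
  | h0 => rw [zero_mul, map_zero, LinearMap.zero_apply, LinearMap.zero_apply]
  | hadd a a' h h' => rw [add_mul, map_add, LinearMap.add_apply, h, h', map_add,
      LinearMap.add_apply]
  | hs r p =>
    induction b using PathAlgebra.induct with
    | h0 => rw [mul_zero, map_zero, LinearMap.zero_apply, map_zero]
    | hadd b b' h h' => rw [mul_add, map_add, LinearMap.add_apply, h, h', map_add,
        LinearMap.add_apply, map_add]
    | hs s q =>
      rw [PathAlgebra.smul_mul', mul_smul', map_smul, map_smul, map_smul, map_smul, LinearMap.smul_apply,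
        LinearMap.smul_apply, LinearMap.smul_apply, LinearMap.smul_apply, map_smul, act_ofPath_mul]

instance [Fintype V] : Module (PathAlgebra k V) (Total M) where
  smul a x := act M a x
  one_smul := act_one
  mul_smul := act_mul
  smul_zero a := map_zero (act M a)
  smul_add a := map_add (act M a)
  add_smul a b x := by
    change act M (a + b) x = act M a x + act M b x
    rw [map_add, LinearMap.add_apply]
  zero_smul x := by
    change act M 0 x = 0
    rw [map_zero, LinearMap.zero_apply]

theorem smul_def [Fintype V] (a : PathAlgebra k V) (x : Total M) : a • x = act M a x := rfl

instance [Fintype V] : IsScalarTower k (PathAlgebra k V) (Total M) where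
  smul_assoc r a x := by rw [smul_def, smul_def, map_smul, LinearMap.smul_apply]

variable (M) in
/-- The component of given degree of the total space. -/
def gr (n : ℤ) : Submodule k (Total M) where
  carrier := {x | ∀ c, c.deg ≠ n → proj M c x = 0}
  add_mem' hx hy c hc := by rw [map_add, hx c hc, hy c hc, add_zero]
  zero_mem' c _ := map_zero _
  smul_mem' a x hx c hc := by rw [map_smul, hx c hc, smul_zero]

theorem of_mem_gr (c : CoveringVertex V) (x : M.obj c) : of M c x ∈ gr M c.deg :=
  fun d hd => proj_of_ne (fun h => hd (by rw [h])) x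

theorem eq_sum_of_mem [Fintype V] {n : ℤ} {x : Total M} (hx : x ∈ gr M n) :
    x = ∑ i : V, of M ⟨i, n⟩ (proj M ⟨i, n⟩ x) := by
  classical
  refine ext fun c => ?_
  rw [map_sum]
  by_cases hc : c.deg = n
  · obtain ⟨i, n⟩ := c
    subst hc
    rw [Finset.sum_eq_single i, proj_of_same]
    · intro j _ hj
      exact proj_of_ne (fun h => hj (congrArg CoveringVertex.vertex h)) _
    · simp
  · rw [hx c hc, Finset.sum_eq_zero]
    intro i _
    exact proj_of_ne (fun h => hc (congrArg CoveringVertex.deg h).symm) _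

theorem isInternal_gr : DirectSum.IsInternal (gr M) := by
  -- The component at `c` of a sum of homogeneous elements sees only the summand of degree `c.deg`;
  -- this gives injectivity.
  have key (z : DirectSum ℤ fun n => gr M n) (c : CoveringVertex V) :
      proj M c (DirectSum.coeAddMonoidHom (gr M) z) = proj M c (z c.deg).1 := by
    induction z using DirectSum.induction_on with
    | zero => simp
    | of n x =>
      rw [DirectSum.coeAddMonoidHom_of, DirectSum.coe_of_apply]
      split_ifs with h
      · rfl
      · rw [x.2 c (Ne.symm h)]
        simp
    | add x y hx hy => rw [map_add, map_add, hx, hy, DirectSum.add_apply, Submodule.coe_add, map_add]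
  constructor
  · intro z z' h
    refine DFinsupp.ext fun n => Subtype.ext (ext fun c => ?_)
    by_cases hc : c.deg = n
    · subst hc
      rw [← key, ← key, h]
    · exact ((z n).2 c hc).trans ((z' n).2 c hc).symm
  · intro x
    induction x using induction with
    | h0 => exact ⟨0, map_zero _⟩
    | hadd x y hx hy =>
      obtain ⟨z, rfl⟩ := hx
      obtain ⟨z', rfl⟩ := hy
      exact ⟨z + z', map_add _ _ _⟩
    | hof c x => exact ⟨DirectSum.of (fun n => gr M n) c.deg ⟨_, of_mem_gr c x⟩,
        DirectSum.coeAddMonoidHom_of _ _ _⟩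

theorem smul_mem_gr [Fintype V] (n : ℕ) (i : ℤ) (a : PathAlgebra k V) (x : Total M)
    (ha : a ∈ degree k V n) (hx : x ∈ gr M i) : a • x ∈ gr M (n + i) := by
  rw [eq_sum_of_mem hx, Finset.smul_sum]
  refine Submodule.sum_mem _ fun j _ => ?_
  generalize proj M ⟨j, i⟩ x = y
  rw [smul_def]
  induction ha using Submodule.span_induction with
  | mem a h =>
    obtain ⟨p, rfl, rfl⟩ := h
    by_cases h : j = p.src
    · obtain ⟨j', l, p⟩ := p
      subst h
      let g : (⟨j, i⟩ : CoveringVertex V) ⟶ ⟨l, p.length + i⟩ := ⟨p, add_comm _ _⟩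
      exact (act_ofHom g y).symm ▸ of_mem_gr (⟨l, p.length + i⟩ : CoveringVertex V) _
    · rw [act_ofPath, pathAct_of_ne h]
      exact zero_mem _
  | zero =>
    rw [map_zero]
    exact zero_mem _
  | add a b _ _ ha hb =>
    rw [map_add]
    exact add_mem ha hb
  | smul r a _ ha =>
    rw [map_smul]
    exact Submodule.smul_mem _ r ha

end Total

variable [Fintype V]

/-- The graded module given by a graded representation. -/
def toGrMod (M : GrRep.{u, v, w, max v t} k V) : GrMod.{u, v, w, max v t} k V where
  carrier := Total M
  gr := Total.gr M
  isInternal := Total.isInternal_gr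
  smul_mem := Total.smul_mem_gr

theorem Total.of_mem_piece (M : GrRep.{u, v, w, max v t} k V) (c : CoveringVertex V)
    (x : M.obj c) : Total.of M c x ∈ (toGrMod.{u, v, w, t} M).piece c :=
  ⟨Total.of_mem_gr c x, Total.act_idem_of c x⟩

theorem Total.of_proj_eq {M : GrRep.{u, v, w, max v t} k V} {c : CoveringVertex V}
    {x : Total M} (hx : x ∈ (toGrMod.{u, v, w, t} M).piece c) :
    Total.of M c (Total.proj M c x) = x := by
  classical
  have h : act M (idem k c.vertex) x = x := hx.2
  have h' := eq_sum_of_mem hx.1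
  conv_rhs => rw [← h, h', map_sum]
  rw [Finset.sum_eq_single c.vertex]
  · exact (act_idem_of c _).symm
  · intro i _ hi
    rw [act_ofPath, pathAct_of_ne]
    exact hi
  · simp

/-- Each component of a graded representation is a piece of its total space. -/
def pieceEquiv (M : GrRep.{u, v, w, max v t} k V) (c : CoveringVertex V) :
    (toGrMod.{u, v, w, t} M).piece c ≃ₗ[k] M.obj c where
  toFun x := Total.proj M c x.1
  map_add' x y := map_add (Total.proj M c) x.1 y.1
  map_smul' r x := map_smul (Total.proj M c) r x.1
  invFun y := ⟨Total.of M c y, Total.of_mem_piece M c y⟩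
  left_inv x := Subtype.ext (Total.of_proj_eq x.2)
  right_inv y := Total.proj_of_same c y

/-- A graded representation is recovered from its total space. -/
def toGrModIso (M : GrRep.{u, v, w, max v t} k V) :
    (GrMod.toGrRep k V).obj (toGrMod.{u, v, w, t} M) ≅ M :=
  NatIso.ofComponents (fun c => (pieceEquiv.{u, v, w, t} M c).toModuleIso) fun {c d} g => by
    ext x
    change Total.proj M d (ofHom k g • (show Total M from x.1)) = M.map g (Total.proj M c x.1)
    conv_lhs => rw [← Total.of_proj_eq x.2]
    rw [Total.smul_def, Total.act_ofHom, Total.proj_of_same]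

end GrRep

namespace GrMod

variable (k : Type u) [Field k] (V : Type v) [Quiver.{w} V] [Fintype V]

/-- The total space is a direct sum indexed by the covering vertices, which lie in `Type v`; hence
the module universe `max v t`. -/
instance : (toGrRep.{u, v, w, max v t} k V).EssSurj where
  mem_essImage M := ⟨_, ⟨GrRep.toGrModIso.{u, v, w, t} M⟩⟩

theorem toGrRep_isEquivalence : (toGrRep.{u, v, w, max v t} k V).IsEquivalence where

end GrMod

/-! ### Comparison of the quotient categories -/

section IsSumOfFinDim

variable {k : Type u} [Field k] {V : Type v} [Quiver.{w} V] [Fintype V]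
  {X : Type t} [AddCommGroup X] [Module k X] [Module (PathAlgebra k V) X]
  [IsScalarTower k (PathAlgebra k V) X]

theorem Submodule.finiteDimensional_sup_of_isScalarTower {F G : Submodule (PathAlgebra k V) X}
    (hF : FiniteDimensional k F) (hG : FiniteDimensional k G) :
    FiniteDimensional k (F ⊔ G : Submodule (PathAlgebra k V) X) := by
  let f := ((Submodule.inclusion (le_sup_left : F ≤ F ⊔ G)).coprod
    (Submodule.inclusion (le_sup_right : G ≤ F ⊔ G))).restrictScalars k
  refine Module.Finite.of_surjective f ?_
  rintro ⟨x, hx⟩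
  obtain ⟨y, hy, z, hz, rfl⟩ := Submodule.mem_sup.1 hx
  exact ⟨(⟨y, hy⟩, ⟨z, hz⟩), rfl⟩

/-- Finite-dimensional submodules are closed under binary sums, so they form a directed family and
their supremum is their union. -/
theorem IsSumOfFinDim.exists_mem (h : IsSumOfFinDim k V X) (x : X) :
    ∃ F : Submodule (PathAlgebra k V) X, FiniteDimensional k F ∧ x ∈ F := by
  have hx : x ∈ sSup {F : Submodule (PathAlgebra k V) X | FiniteDimensional k F} := by
    rw [h]
    trivial
  have hbot : FiniteDimensional k (⊥ : Submodule (PathAlgebra k V) X) :=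
    Module.Finite.of_surjective (0 : k →ₗ[k] _) fun _ => ⟨0, Subsingleton.elim _ _⟩
  rw [Submodule.mem_sSup_of_directed ⟨⊥, hbot⟩] at hx
  · exact hx
  · exact fun F hF G hG => ⟨F ⊔ G, Submodule.finiteDimensional_sup_of_isScalarTower hF hG,
      le_sup_left, le_sup_right⟩

variable (k) in
theorem Submodule.exists_mk_rightInverse (R : Submodule (PathAlgebra k V) X) :
    ∃ s : (X ⧸ R) →ₗ[k] X, ∀ z, Submodule.Quotient.mk (s z) = z := by
  let π : X →ₗ[k] (X ⧸ R) := R.mkQ.restrictScalars k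
  have hπ : Function.Surjective π := Submodule.Quotient.mk_surjective R
  obtain ⟨s, hs⟩ := LinearMap.exists_rightInverse_of_surjective π (LinearMap.range_eq_top.2 hπ)
  exact ⟨s, LinearMap.congr_fun hs⟩

theorem QuiverPath.finite_length_lt [∀ i j : V, Finite (i ⟶ j)] (n : ℕ) :
    {p : QuiverPath V | p.length < n}.Finite := by
  let f : (Σ (l : Fin n) (i j : V), {p : Quiver.Path i j // p.length = l.1}) → QuiverPath V :=
    fun x => ⟨x.2.1, x.2.2.1, x.2.2.2.1⟩
  exact (Set.finite_range f).subset fun p hp => ⟨⟨⟨_, hp⟩, p.src, p.tgt, p.path, rfl⟩, rfl⟩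

/-- A module in which every element is killed by all sufficiently long paths is the sum of its
finite-dimensional submodules. -/
theorem isSumOfFinDim_of_forall_exists [∀ i j : V, Finite (i ⟶ j)]
    (h : ∀ x : X, ∃ n, ∀ p : QuiverPath V, n ≤ p.length → ofPath k p • x = 0) :
    IsSumOfFinDim k V X := by
  refine eq_top_iff.2 fun x _ => ?_
  obtain ⟨n, hn⟩ := h x
  refine le_sSup (a := Submodule.span (PathAlgebra k V) {x}) ?_
    (Submodule.mem_span_singleton_self x)
  -- The cyclic submodule is spanned by the translates of `x` under the finitely many paths of
  -- length less than `n`.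
  let S := Submodule.span k ((fun p => ofPath k p • x) '' {p : QuiverPath V | p.length < n})
  have hS : FiniteDimensional k S :=
    FiniteDimensional.span_of_finite k ((QuiverPath.finite_length_lt n).image _)
  have hle : (Submodule.span (PathAlgebra k V) {x}).restrictScalars k ≤ S := by
    intro y hy
    obtain ⟨a, rfl⟩ := Submodule.mem_span_singleton.1 hy
    clear hy
    induction a using PathAlgebra.induct with
    | h0 => simp
    | hadd a b ha hb =>
      rw [add_smul]
      exact add_mem ha hb
    | hs r p =>
      rw [smul_assoc]
      refine Submodule.smul_mem _ r ?_
      by_cases hp : p.length < n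
      · exact Submodule.subset_span ⟨p, hp, rfl⟩
      · rw [hn p (not_lt.1 hp)]
        exact zero_mem _
  exact Submodule.finiteDimensional_of_le hle

end IsSumOfFinDim

/-! ### Degree bounds and torsion of kernels and cokernels -/

namespace GrMod

variable {k : Type u} [Field k] {V : Type v} [Quiver.{w} V] [Fintype V]

/-- The subspace of the elements whose components of degree at least `n` vanish. -/
def degLT (M : GrMod.{u, v, w, t} k V) (n : ℤ) : Submodule k M.carrier where
  carrier := {x | ∀ i, n ≤ i → (DirectSum.decompose M.gr x i : M.carrier) = 0}
  add_mem' hx hy i hi := by simp [hx i hi, hy i hi]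
  zero_mem' i _ := by simp
  smul_mem' r x hx i hi := by
    rw [DirectSum.decompose_smul]
    exact (congrArg (r • ·) (hx i hi)).trans (smul_zero r)

variable {M N : GrMod.{u, v, w, t} k V}

theorem degLT_mono {m n : ℤ} (h : m ≤ n) : M.degLT m ≤ M.degLT n :=
  fun _ hx i hi => hx i (h.trans hi)

theorem exists_le_degLT (F : Submodule k M.carrier) [FiniteDimensional k F] :
    ∃ n, F ≤ M.degLT n := by
  classical
  refine Submodule.fg_induction (motive := fun F _ => ∃ n, F ≤ M.degLT n) ?_ ?_ F
    (Module.Finite.iff_fg.1 inferInstance)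
  · intro x
    obtain ⟨n, hn⟩ := (DirectSum.decompose M.gr x).support.bddAbove
    refine ⟨n + 1, (Submodule.span_singleton_le_iff_mem _ _).2 fun i hi => ?_⟩
    by_contra h
    have := hn (show i ∈ (DirectSum.decompose M.gr x).support by
      rw [DFinsupp.mem_support_toFun]
      intro h'
      exact h (by rw [h']; rfl))
    omega
  · rintro F G - - ⟨m, hm⟩ ⟨n, hn⟩
    exact ⟨max m n, sup_le (hm.trans (degLT_mono (le_max_left _ _)))
      (hn.trans (degLT_mono (le_max_right _ _)))⟩

theorem eq_zero_of_mem_degLT {n i : ℤ} {x : M.carrier} (hx : x ∈ M.degLT n) (hi : n ≤ i)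
    (hx' : x ∈ M.gr i) : x = 0 :=
  (DirectSum.decompose_of_mem_same _ hx').symm.trans (hx i hi)

/-- Converts a bound on the target degree into a bound on the length: a path out of `c` ends in
degree `c.deg + p.length`. -/
theorem smul_mem_of_forall_hom {c : CoveringVertex V} {x : M.carrier} (hx : x ∈ M.piece c)
    (R : Submodule (PathAlgebra k V) M.carrier) {n : ℤ}
    (h : ∀ d (g : c ⟶ d), n ≤ d.deg → ofHom k g • x ∈ R) (p : QuiverPath V)
    (hp : (n - c.deg).toNat ≤ p.length) : ofPath k p • x ∈ R := by
  by_cases hc : c.vertex = p.src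
  · obtain ⟨i, m⟩ := c
    obtain ⟨i', j, p⟩ := p
    subst hc
    refine h ⟨j, m + p.length⟩ ⟨p, rfl⟩ ?_
    change (n - m).toNat ≤ p.length at hp
    dsimp only
    omega
  · rw [ofPath_smul_eq_zero hx hc]
    exact zero_mem _

theorem exists_forall_add_smul_mem (R : Submodule (PathAlgebra k V) M.carrier) (x y : M.carrier)
    (hx : ∃ n, ∀ p : QuiverPath V, n ≤ p.length → ofPath k p • x ∈ R)
    (hy : ∃ n, ∀ p : QuiverPath V, n ≤ p.length → ofPath k p • y ∈ R) :
    ∃ n, ∀ p : QuiverPath V, n ≤ p.length → ofPath k p • (x + y) ∈ R := by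
  obtain ⟨m, hm⟩ := hx
  obtain ⟨n, hn⟩ := hy
  refine ⟨max m n, fun p hp => ?_⟩
  rw [smul_add]
  exact add_mem (hm p (le_of_max_le_left hp)) (hn p (le_of_max_le_right hp))

/-- A finite-dimensional submodule containing `x` has bounded degrees, while `ofHom k g • x` is
homogeneous of degree `d.deg`. Conversely, elements of the kernel are finite sums of homogeneous
ones, so each is killed by long paths. -/
theorem isSumOfFinDim_ker_iff [∀ i j : V, Finite (i ⟶ j)] (f : M ⟶ N) :
    IsSumOfFinDim k V (LinearMap.ker f.toLinearMap) ↔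
      ∀ c, ∀ x ∈ M.piece c, f.toLinearMap x = 0 →
        ∃ n : ℤ, ∀ d (g : c ⟶ d), n ≤ d.deg → ofHom k g • x = 0 := by
  constructor
  · intro h c x hx hfx
    obtain ⟨F, hF, hxF⟩ := h.exists_mem ⟨x, hfx⟩
    have : FiniteDimensional k (F.restrictScalars k) := hF
    obtain ⟨n, hn⟩ := exists_le_degLT ((F.restrictScalars k).map
      ((LinearMap.ker f.toLinearMap).subtype.restrictScalars k))
    refine ⟨n, fun d g hd => eq_zero_of_mem_degLT (hn ?_) hd (ofHom_smul_mem g hx).1⟩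
    exact ⟨ofHom k g • ⟨x, hfx⟩, F.smul_mem _ hxF, rfl⟩
  · intro h
    refine isSumOfFinDim_of_forall_exists fun ⟨x, hx⟩ => ?_
    obtain ⟨n, hn⟩ := ker_induction f x hx
      (P := fun x => ∃ n, ∀ p : QuiverPath V, n ≤ p.length →
        ofPath k p • x ∈ (⊥ : Submodule (PathAlgebra k V) M.carrier))
      ⟨0, fun p _ => by simp⟩ (exists_forall_add_smul_mem ⊥) (fun c x hx hfx => by
        obtain ⟨n, hn⟩ := h c x hx hfx
        exact ⟨_, smul_mem_of_forall_hom hx ⊥ hn⟩)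
    exact ⟨n, fun p hp => Subtype.ext (hn p hp)⟩

/-- The quotient is given no grading here, so a `k`-linear section carries a finite-dimensional
submodule of it to a subspace of `N`, where degrees can be bounded. -/
theorem isSumOfFinDim_coker_iff [∀ i j : V, Finite (i ⟶ j)] (f : M ⟶ N) :
    IsSumOfFinDim k V (N.carrier ⧸ LinearMap.range f.toLinearMap) ↔
      ∀ c, ∀ y ∈ N.piece c, ∃ n : ℤ, ∀ d (g : c ⟶ d), n ≤ d.deg →
        ∃ x ∈ M.piece d, f.toLinearMap x = ofHom k g • y := by
  constructor
  · intro h c y hy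
    obtain ⟨F, hF, hyF⟩ := h.exists_mem (Submodule.Quotient.mk y)
    have : FiniteDimensional k (F.restrictScalars k) := hF
    obtain ⟨s, hs⟩ := Submodule.exists_mk_rightInverse (k := k) (LinearMap.range f.toLinearMap)
    obtain ⟨n, hn⟩ := exists_le_degLT ((F.restrictScalars k).map s)
    refine ⟨n, fun d g hd => ?_⟩
    have hgy := ofHom_smul_mem g hy
    have hz : Submodule.Quotient.mk (ofHom k g • y) ∈ F := F.smul_mem (ofHom k g) hyF
    have hsz := hn ⟨_, hz, rfl⟩
    set z := s (Submodule.Quotient.mk (ofHom k g • y))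
    obtain ⟨x, hx⟩ : ofHom k g • y - z ∈ LinearMap.range f.toLinearMap :=
      (Submodule.Quotient.eq _).1 (hs _).symm
    -- In degree `d.deg` the correction `z` vanishes, so that component of `x` maps to `ofHom k g •
    -- y`; the idempotent at `d.vertex` then moves it into the piece over `d`.
    have hfx := coe_decompose_map f x d.deg
    rw [hx, DirectSum.decompose_sub, DirectSum.sub_apply, Submodule.coe_sub, hsz _ hd, sub_zero,
      DirectSum.decompose_of_mem_same _ hgy.1] at hfx
    refine ⟨idem k d.vertex • (DirectSum.decompose M.gr x d.deg).1,
      idem_smul_mem_piece (Subtype.property _) _, ?_⟩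
    rw [map_smul, hfx, hgy.2]
  · intro h
    refine isSumOfFinDim_of_forall_exists fun y => ?_
    obtain ⟨y, rfl⟩ := Submodule.Quotient.mk_surjective _ y
    suffices ∃ n, ∀ p : QuiverPath V, n ≤ p.length →
        ofPath k p • y ∈ LinearMap.range f.toLinearMap by
      obtain ⟨n, hn⟩ := this
      exact ⟨n, fun p hp => (Submodule.Quotient.mk_eq_zero _).2 (hn p hp)⟩
    induction y using piece_induction with
    | h0 => exact ⟨0, fun p _ => by simp⟩
    | hadd x y hx hy => exact exists_forall_add_smul_mem _ x y hx hy
    | hp c y hy =>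
      obtain ⟨n, hn⟩ := h c y hy
      refine ⟨_, smul_mem_of_forall_hom hy _ (n := n) fun d g hd => ?_⟩
      obtain ⟨x, -, hx⟩ := hn d g hd
      exact ⟨x, hx⟩

theorem isoModFdim_eq_inverseImage [∀ i j : V, Finite (i ⟶ j)] :
    isoModFdim.{u, v, w, t} k V = (GrRep.isoModTorsion k V).inverseImage (toGrRep k V) := by
  ext M N f
  refine (and_congr (isSumOfFinDim_ker_iff f) (isSumOfFinDim_coker_iff f)).trans ?_
  refine and_congr ?_ ?_
  · constructor
    · intro h c x hx
      obtain ⟨n, hn⟩ := h c x.1 x.2 (congrArg Subtype.val hx)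
      exact ⟨n, fun d g hd => Subtype.ext (hn d g hd)⟩
    · intro h c x hx hfx
      obtain ⟨n, hn⟩ := h c ⟨x, hx⟩ (Subtype.ext hfx)
      exact ⟨n, fun d g hd => congrArg Subtype.val (hn d g hd)⟩
  · constructor
    · intro h c y
      obtain ⟨n, hn⟩ := h c y.1 y.2
      refine ⟨n, fun d g hd => ?_⟩
      obtain ⟨x, hx, hxy⟩ := hn d g hd
      exact ⟨⟨x, hx⟩, Subtype.ext hxy⟩
    · intro h c y hy
      obtain ⟨n, hn⟩ := h c ⟨y, hy⟩
      refine ⟨n, fun d g hd => ?_⟩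
      obtain ⟨x, hx⟩ := hn d g hd
      exact ⟨x.1, x.2, congrArg Subtype.val hx⟩

end GrMod

/-! ### Equivalences of quotient categories and incidence matrices -/

theorem QGr.nonempty_equivalence_localization (k : Type u) [Field k] (V : Type v) [Quiver.{w} V]
    [Fintype V] [∀ i j : V, Finite (i ⟶ j)] :
    Nonempty (QGr.{u, v, w, max v t} k V ≌
      (GrRep.isoModTorsion.{u, v, w, max v t} k V).Localization) := by
  have := GrMod.toGrRep_isEquivalence.{u, v, w, t} k V
  exact (GrMod.toGrRep.{u, v, w, max v t} k V).asEquivalence.toAdjunction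
    |>.nonempty_localization_equivalence _ _ GrMod.isoModFdim_eq_inverseImage

theorem QGr.nonempty_equivalence (k : Type u) [Field k] {V V' : Type v} [Quiver.{w} V]
    [Quiver.{w'} V'] [Fintype V] [Fintype V'] [∀ i j : V, Finite (i ⟶ j)]
    [∀ i j : V', Finite (i ⟶ j)] {m : ℕ} (E : VeroneseData m V V') (hm : 1 ≤ m) :
    Nonempty (QGr.{u, v, w, max v w w' t} k V ≌ QGr.{u, v, w', max v w w' t} k V') := by
  obtain ⟨e₁⟩ := QGr.nonempty_equivalence_localization.{u, v, w, max w w' t} k V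
  obtain ⟨e₂⟩ := GrRep.nonempty_localization_equivalence.{u, v, w, t, w'} (k := k) E hm
  obtain ⟨e₃⟩ := QGr.nonempty_equivalence_localization.{u, v, w', max w w' t} k V'
  exact ⟨e₁.trans (e₂.trans e₃.symm)⟩

theorem Veronese.finite_hom {V : Type v} [Quiver.{w} V] [Finite V] [∀ i j : V, Finite (i ⟶ j)]
    {m : ℕ} (i j : Veronese m V) : Finite (i ⟶ j) :=
  Quiver.Path.finite_length (V := V) i j m

theorem Veronese.incidenceMatrix_eq {V : Type v} [Quiver.{w} V] [Fintype V] [DecidableEq V]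
    [∀ i j : V, Finite (i ⟶ j)] (m : ℕ) :
    incidenceMatrix (Veronese m V) = (incidenceMatrix V ^ m : Matrix V V ℕ) :=
  Matrix.ext fun i j => Quiver.Path.card_length (V := V) j i m

/-- The identification of the arrows of the Veronese quiver with paths. -/
def VeroneseData.ofVeronese (m : ℕ) (V : Type v) [Quiver.{w} V] :
    VeroneseData m V (Veronese m V) where
  vertexEquiv := Equiv.refl V
  homEquiv _ _ := Equiv.refl _

/-- A finite quiver whose incidence matrix is the `m`-th power of that of `V` is identified with
the `m`-th Veronese of `V`. -/
theorem VeroneseData.nonempty_of_incidenceMatrix_eq {V : Type v} [Quiver.{w} V] [Fintype V]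
    [DecidableEq V] [∀ i j : V, Finite (i ⟶ j)] {V' : Type*} [Quiver V']
    [∀ i j : V', Finite (i ⟶ j)] {m : ℕ} (e : V' ≃ V)
    (h : incidenceMatrix V' = (incidenceMatrix V ^ m).submatrix e e) :
    Nonempty (VeroneseData m V V') :=
  -- Finite sets of equal cardinality are in bijection. The indices are swapped because the entry
  -- `(j, i)` counts the arrows from `i` to `j`.
  ⟨⟨e, fun i j => Classical.choice <| Finite.card_eq.1 <|
    (congrFun (congrFun h j) i).trans (Quiver.Path.card_length (e i) (e j) m).symm⟩⟩

end

theorem mainTheorem8 (k : Type u) [Field k]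
    (V : Type v) [Quiver.{w} V] [Fintype V] [DecidableEq V] [∀ i j : V, Finite (i ⟶ j)]
    (m : ℕ) (hm : 1 ≤ m) :
    -- the quiver whose arrows are the paths of length `m` is finite, it has incidence matrix
    -- `C ^ m`, and the equivalence holds for it
    ((∀ i j : Veronese m V, Finite (i ⟶ j)) ∧
      incidenceMatrix (Veronese m V) = (incidenceMatrix V ^ m : Matrix V V ℕ) ∧
      Nonempty (QGr.{u, v, w, max u v w} k V ≌
        QGr.{u, v, max v w, max u v w} k (Veronese m V))) ∧
    -- the equivalence holds for every finite quiver with incidence matrix `C ^ m`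
    (∀ (V' : Type v) [Quiver.{w} V'] [Fintype V'] [∀ i j : V', Finite (i ⟶ j)] (e : V' ≃ V),
      incidenceMatrix V' = (incidenceMatrix V ^ m).submatrix e e →
        Nonempty (QGr.{u, v, w, max u v w} k V ≌ QGr.{u, v, w, max u v w} k V')) := by
  have hfin (i j : Veronese m V) : Finite (i ⟶ j) := Veronese.finite_hom i j
  refine ⟨⟨hfin, Veronese.incidenceMatrix_eq m, ?_⟩, fun V' _ _ _ e he => ?_⟩
  · exact QGr.nonempty_equivalence.{u, v, w, u, max v w} k (VeroneseData.ofVeronese m V) hm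
  · obtain ⟨E⟩ := VeroneseData.nonempty_of_incidenceMatrix_eq e he
    exact QGr.nonempty_equivalence.{u, v, w, u, w} k E hm
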